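/- Let $F:\mathbb{R}^n\rightrightarrows\mathbb{R}^q$ be a set-valued map, with graph $\operatorname{gr}F=\{(x,y): y\in F(x)\}$ and domain $\operatorname{dom}F=\{x: F(x)\ne\emptyset\}$. A point $\bar x$ is an \emph{optimizer} of $F$ if there is no $x$ with $F(x)\supsetneq F(\bar x)$. For $Y\subseteq\mathbb{R}^q$ let $v_F(Y)=\{z: \exists x\in\mathbb{R}^n,\ z\in F(x),\ Y\subseteq F(x)\}$; $Y$ \emph{generates a fixed point} of $v_F$ if $v_F(Y)=v_F(Z)$ for some $Z\subseteq\mathbb{R}^q$ with $Z=v_F(Z)$. The \emph{recession function} $G$ of $F$ is the set-valued map whose graph is the recession cone of $\operatorname{gr}F$, and $K=\{y: \exists x\in\mathbb{R}^n,\ y\in G(x),\ 0\in G(x)\}$ is the \emph{natural ordering cone} of $F$. The \emph{optimizer design algorithm} starts with $Y=\emptyset$. While $Y$ does not generate a fixed point of $v_F$, it performs a decision-making step: some $y\in v_F(Y)$ is chosen and $Y$ is replaced by $Y\cup\{y\}$. When $Y$ generates a fixed point, it determines some $x$ with $v_F(Y)=F(x)$, returns $x$ and stops. A decision-making step is \emph{qualified}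 if the chosen $y$ belongs to a minimal (with respect to $\subseteq$, among nonempty faces) face $S$ of $v_F(Y)$ with $S\cap Y=\emptyset$. \textbf{Theorem.} Assume that (i) $F$ is polyhedral convex, that is, $\operatorname{gr}F$ is a convex polyhedron, and $\operatorname{dom}F\neq\emptyset$; and (ii) $K=G(0)$. Then, whenever the algorithm reaches a decision-making step, a qualified choice of $y$ exists. Moreover, every execution of the algorithm in which (iii) all but at most finitely many decision-making steps are qualified terminates after finitely many steps, and it returns an optimizer $x$ of $F$ with $v_F(Y)=F(x)$ for the final set $Y$. -/

import Mathlib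

namespace OptimizerDesign

/-- A convex polyhedron: the solution set of finitely many non-strict affine inequalities. -/
def IsPolyhedron {V : Type*} [AddCommGroup V] [Module ℝ V] (P : Set V) : Prop :=
  ∃ (m : ℕ) (a : Fin m → V →ₗ[ℝ] ℝ) (b : Fin m → ℝ), P = {v | ∀ i, a i v ≤ b i}

/-- The recession cone `0⁺Q` of a (nonempty) convex set. -/
def recessionCone {V : Type*} [AddCommGroup V] [Module ℝ V] (Q : Set V) : Set V :=
  {d | ∀ p ∈ Q, ∀ t : ℝ, 0 ≤ t → p + t • d ∈ Q}

/-- A nonempty face of a convex set `P`: a nonempty convex subset `S` such that every open segment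
in `P` that meets `S` has its endpoints in `S`. -/
def IsFace {V : Type*} [AddCommGroup V] [Module ℝ V] (P S : Set V) : Prop :=
  S.Nonempty ∧ Convex ℝ S ∧ IsExtreme ℝ P S

section SetValued

variable {n q : ℕ}

/-- The graph of a set-valued map. -/
def graph (F : (Fin n → ℝ) → Set (Fin q → ℝ)) : Set ((Fin n → ℝ) × (Fin q → ℝ)) :=
  {p | p.2 ∈ F p.1}

/-- The domain of a set-valued map. -/
def dom (F : (Fin n → ℝ) → Set (Fin q → ℝ)) : Set (Fin n → ℝ) :=
  {x | (F x).Nonempty}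

/-- `F` is polyhedral convex: its graph is a convex polyhedron. -/
def IsPolyhedralConvex (F : (Fin n → ℝ) → Set (Fin q → ℝ)) : Prop :=
  IsPolyhedron (graph F)

/-- `x` is an optimizer of `F`: no value of `F` is a strict superset of `F x`. -/
def IsOptimizer (F : (Fin n → ℝ) → Set (Fin q → ℝ)) (x : Fin n → ℝ) : Prop :=
  ¬ ∃ x', F x ⊂ F x'

/-- The value function `v_F`. -/
def valueFun (F : (Fin n → ℝ) → Set (Fin q → ℝ)) (Y : Set (Fin q → ℝ)) : Set (Fin q → ℝ) :=
  {z | ∃ x, z ∈ F x ∧ Y ⊆ F x}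

/-- `Y` generates a fixed point of `v_F`. -/
def GeneratesFixedPoint (F : (Fin n → ℝ) → Set (Fin q → ℝ)) (Y : Set (Fin q → ℝ)) : Prop :=
  ∃ Z : Set (Fin q → ℝ), Z = valueFun F Z ∧ valueFun F Y = valueFun F Z

/-- The recession function `G` of `F`: its graph is the recession cone of the graph of `F`. -/
def recessionFun (F : (Fin n → ℝ) → Set (Fin q → ℝ)) (x : Fin n → ℝ) : Set (Fin q → ℝ) :=
  {y | (x, y) ∈ recessionCone (graph F)}

/-- The natural ordering cone `K` of `F`. -/
def naturalOrderingCone (F : (Fin n → ℝ) → Set (Fin q → ℝ)) : Set (Fin q → ℝ) :=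
  {y | ∃ x, y ∈ recessionFun F x ∧ 0 ∈ recessionFun F x}

/-- The choice of `y`, when the current set is `Y`, is qualified: `y` belongs to a minimal face
of `v_F(Y)` that does not meet `Y`. -/
def IsQualified (F : (Fin n → ℝ) → Set (Fin q → ℝ)) (Y : Set (Fin q → ℝ)) (y : Fin q → ℝ) :
    Prop :=
  ∃ S, Minimal (IsFace (valueFun F Y)) S ∧ S ∩ Y = ∅ ∧ y ∈ S

/-- Configurations of the optimizer design algorithm. -/
inductive Config (n q : ℕ) : Type
  /-- The loop condition is about to be tested for the current set `Y`. -/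
  | loop (Y : Set (Fin q → ℝ)) : Config n q
  /-- The algorithm has stopped with final set `Y` and output `x`. -/
  | done (Y : Set (Fin q → ℝ)) (x : Fin n → ℝ) : Config n q

/-- The optimizer design algorithm for `F`: while `Y` does not generate a fixed point of `v_F`,
some `y ∈ v_F(Y)` is chosen and `Y` is replaced by `Y ∪ {y}`; after the loop, some `x` with
`v_F(Y) = F(x)` is returned. The initial configuration is `loop ∅`. -/
inductive Step (F : (Fin n → ℝ) → Set (Fin q → ℝ)) : Config n q → Config n q → Prop
  | decision (Y : Set (Fin q → ℝ)) (y : Fin q → ℝ) (hguard : ¬ GeneratesFixedPoint F Y)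
      (hy : y ∈ valueFun F Y) : Step F (Config.loop Y) (Config.loop (Y ∪ {y}))
  | output (Y : Set (Fin q → ℝ)) (x : Fin n → ℝ) (hguard : GeneratesFixedPoint F Y)
      (hx : valueFun F Y = F x) : Step F (Config.loop Y) (Config.done Y x)

/-- The pass from `s` to `t` is a decision-making step in which the choice of `y` is not qualified.
(If `y ∉ Y`, then `y` is determined by `Y` and `Y ∪ {y}`; if `y ∈ Y`, then `y` is not qualified,
so the configurations alone decide whether a step is qualified.) -/
def IsUnqualifiedStep (F : (Fin n → ℝ) → Set (Fin q → ℝ)) (s t : Config n q) : Prop :=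
  ∃ Y y, ¬ GeneratesFixedPoint F Y ∧ y ∈ valueFun F Y ∧
    s = Config.loop Y ∧ t = Config.loop (Y ∪ {y}) ∧ ¬ IsQualified F Y y

/-- `s 0, s 1, …` is a complete execution of the algorithm with `N ∈ ℕ ∪ {∞}` steps: it starts with
`Y = ∅`, performs `N` steps, and, if `N` is finite, no further step is possible. The values `s k`
for `k > N` are irrelevant. -/
structure IsExecution (F : (Fin n → ℝ) → Set (Fin q → ℝ)) (N : ℕ∞) (s : ℕ → Config n q) :
    Prop where
  start : s 0 = Config.loop ∅
  step : ∀ k : ℕ, (k : ℕ∞) < N → Step F (s k) (s (k + 1))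
  complete : ∀ m : ℕ, N = (m : ℕ∞) → ∀ t, ¬ Step F (s m) t

end SetValued

end OptimizerDesign

open OptimizerDesign

/-!
Why the theorem is true. A nonempty fixed point `Z` of `v_F` is a value `F x` at an optimizer `x`,
so whenever the loop stops an output exists and every possible output is an optimizer.

*Existence of a qualified choice.* Let `Y` be finite and `Y ⊆ F x`. Then `v_F(Y)` is the projection
of a polyhedron, and Fourier–Motzkin elimination (`exists_dual_description`) describes it by
inequalities `α k z ≤ β k`. The coefficients of the eliminated system do not depend on the
right-hand sides, so for `Y ≠ ∅` the solutions of `α k d ≤ 0` are elements of `K = G(0)`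
(`exists_description_valueFun`); hence `F x` is closed under adding them. A polyhedron is contained
in every convex set that is closed under its recession directions and meets all of its minimal faces
(`subset_of_meets_minimal_faces`). So if `Y` met all minimal faces of `v_F(Y)`, then
`v_F(Y) ⊆ F x`, and `v_F(Y) = F x` would be a fixed point.

*Termination.* Let `Y₀ ⊆ Y₁ ⊆ …` be the sets produced by an infinite execution, let `y_k` be the
element chosen for `Y_k`, and let `Y_N ⊆ F x`. Then all `y_k` with `k < N` lie in `F x`, and `F x` is
contained in `v_F(Y_k)` for all `k ≤ N`. If `j < k` and the same inequalities of `F x` are active at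
`y_j` and `y_k`, then the segment from `y_j` to `y_k` can be prolonged beyond `y_k` inside `F x`, so
every face of `v_F(Y_k)` that contains `y_k` contains `y_j ∈ Y_k`, and the choice of `y_k` is not
qualified. Thus the number of qualified steps is at most the number `2 ^ m` of possible active sets.
-/

namespace OptimizerDesign

/-! ### Fourier–Motzkin elimination -/

/-- Elimination of one real variable. -/
lemma exists_forall_mul_le_iff {κ : Type*} [Finite κ] (g h : κ → ℝ) :
    (∃ t : ℝ, ∀ k, t * g k ≤ h k) ↔
      (∀ k, g k = 0 → 0 ≤ h k) ∧ ∀ k l, 0 < g k → g l < 0 → 0 ≤ g k * h l - g l * h k := by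
  constructor
  · rintro ⟨t, ht⟩
    refine ⟨fun k hk => by simpa [hk] using ht k, fun k l hk hl => ?_⟩
    have h1 := mul_le_mul_of_nonneg_left (ht l) hk.le
    have h2 := mul_le_mul_of_nonpos_left (ht k) hl.le
    nlinarith
  · rintro ⟨h0, hpn⟩
    -- the lower bounds and the upper bounds for the eliminated variable
    let s : Set ℝ := (fun l => h l / g l) '' {l | g l < 0}
    let u : Set ℝ := (fun k => h k / g k) '' {k | 0 < g k}
    have hs : s.Finite := (Set.toFinite _).image _
    have hu : u.Finite := (Set.toFinite _).image _
    have hsu : ∀ a ∈ s, ∀ c ∈ u, a ≤ c := by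
      rintro _ ⟨l, hl, rfl⟩ _ ⟨k, hk, rfl⟩
      have hl' : g l < 0 := hl
      have hk' : 0 < g k := hk
      have := hpn k l hk' hl'
      change h l / g l ≤ h k / g k
      rw [div_le_iff_of_neg hl', div_mul_eq_mul_div, div_le_iff₀ hk']
      linarith
    obtain ⟨t, hts, htu⟩ : ∃ t, (∀ a ∈ s, a ≤ t) ∧ ∀ c ∈ u, t ≤ c := by
      rcases s.eq_empty_or_nonempty with he | hne
      · obtain ⟨t, ht⟩ := hu.bddBelow
        exact ⟨t, by simp [he], fun c hc => ht hc⟩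
      rcases u.eq_empty_or_nonempty with he | hne'
      · obtain ⟨t, ht⟩ := hs.bddAbove
        exact ⟨t, fun a ha => ht ha, by simp [he]⟩
      obtain ⟨t, h1, h2⟩ := exists_between_of_forall_le hne hne' hsu
      exact ⟨t, fun a ha => h1 ha, fun c hc => h2 hc⟩
    refine ⟨t, fun k => ?_⟩
    rcases lt_trichotomy (g k) 0 with hk | hk | hk
    · have := hts _ ⟨k, hk, rfl⟩
      exact (div_le_iff_of_neg hk).1 this
    · simpa [hk] using h0 k hk
    · have := htu _ ⟨k, hk, rfl⟩
      exact (le_div_iff₀ hk).1 this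

/-- The cone of right-hand sides for which a system of linear inequalities is solvable is
polyhedral. -/
lemma exists_dual_description (n : ℕ) {ι : Type} (c : ι → (Fin n → ℝ) →ₗ[ℝ] ℝ) [Finite ι] :
    ∃ (κ : Type) (_ : Finite κ) (l : κ → (ι → ℝ) →ₗ[ℝ] ℝ),
      ∀ w : ι → ℝ, (∃ x, ∀ i, c i x ≤ w i) ↔ ∀ k, 0 ≤ l k w := by
  induction n with
  | zero =>
    refine ⟨ι, inferInstance, LinearMap.proj, fun w => ?_⟩
    have hx : ∀ x : Fin 0 → ℝ, ∀ i, c i x = 0 := fun x i => by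
      rw [Subsingleton.elim x 0, map_zero]
    simp [hx]
  | succ n ih =>
    -- `x = (t, x')`, where `c i x = t * e i + c' i x'`
    let c' : ι → (Fin n → ℝ) →ₗ[ℝ] ℝ := fun i =>
      ∑ j, (c i (Pi.single j.succ 1)) • LinearMap.proj j
    let e : ι → ℝ := fun i => c i (Pi.single 0 1)
    have hc : ∀ i t x', c i (Fin.cons t x') = t * e i + c' i x' := by
      intro i t x'
      rw [LinearMap.pi_apply_eq_sum_univ (c i), Fin.sum_univ_succ]
      simp only [Fin.cons_zero, Fin.cons_succ, smul_eq_mul, c', e, LinearMap.sum_apply,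
        LinearMap.smul_apply, LinearMap.proj_apply]
      congr 1
      · congr 2; ext j; simp [Pi.single_apply, eq_comm]
      · refine Finset.sum_congr rfl fun j _ => ?_
        rw [mul_comm]
        congr 2; ext j'; simp [Pi.single_apply, eq_comm]
    obtain ⟨κ, hκ, l, hl⟩ := ih c'
    classical
    let p : κ × κ → (ι → ℝ) →ₗ[ℝ] ℝ := fun k =>
      if l k.1 e = 0 then l k.1
      else if 0 < l k.1 e ∧ l k.2 e < 0 then l k.1 e • l k.2 - l k.2 e • l k.1
      else 0
    refine ⟨κ × κ, inferInstance, p, fun w => ?_⟩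
    have h1 : (∃ x, ∀ i, c i x ≤ w i) ↔ ∃ t : ℝ, ∀ k, t * l k e ≤ l k w := by
      have h2 : ∀ t : ℝ, (∃ x', ∀ i, c' i x' ≤ (w - t • e) i) ↔ ∀ k, t * l k e ≤ l k w := by
        intro t
        rw [hl]
        simp
      simp_rw [← h2]
      constructor
      · rintro ⟨x, hx⟩
        refine ⟨x 0, Fin.tail x, fun i => ?_⟩
        have := hx i
        rw [← Fin.cons_self_tail x, hc] at this
        simp only [Pi.sub_apply, Pi.smul_apply, smul_eq_mul]
        linarith
      · rintro ⟨t, x', hx⟩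
        refine ⟨Fin.cons t x', fun i => ?_⟩
        have := hx i
        simp only [Pi.sub_apply, Pi.smul_apply, smul_eq_mul] at this
        rw [hc]
        linarith
    rw [h1, exists_forall_mul_le_iff]
    constructor
    · rintro ⟨ha, hb⟩ ⟨k, k'⟩
      by_cases h0 : l k e = 0
      · simpa [p, h0] using ha k h0
      · by_cases hp : 0 < l k e ∧ l k' e < 0
        · simpa [p, h0, hp] using hb k k' hp.1 hp.2
        · simp [p, h0, hp]
    · intro hp
      refine ⟨fun k hk => by simpa [p, hk] using hp (k, k), fun k k' hk hk' => ?_⟩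
      simpa [p, hk.ne', hk, hk'] using hp (k, k')

/-! ### Minimal faces of polyhedra -/

section Polyhedron

variable {W κ : Type*} [AddCommGroup W] [Module ℝ W]

/-- Moving from `z` along a direction that keeps the active constraints active and that is not a
recession direction, one reaches a point of the polyhedron with fewer inactive constraints. -/
lemma exists_fewer_inactive [Finite κ] (α : κ → W →ₗ[ℝ] ℝ) (β : κ → ℝ) {z d : W}
    (hz : ∀ k, α k z ≤ β k) (hd : ∀ k, α k z = β k → α k d = 0) (hpos : ∃ k, 0 < α k d) :
    ∃ t : ℝ, 0 < t ∧ (∀ k, α k (z + t • d) ≤ β k) ∧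
      {k | α k (z + t • d) < β k} ⊂ {k | α k z < β k} := by
  obtain ⟨k₀, hk₀, hmin⟩ := Set.exists_min_image {k | 0 < α k d}
    (fun k => (β k - α k z) / α k d) (Set.toFinite _) hpos
  have hk₀' : 0 < α k₀ d := hk₀
  have hlt : ∀ k, α k d ≠ 0 → α k z < β k := fun k hk => (hz k).lt_of_ne fun h => hk (hd k h)
  have ht : 0 < (β k₀ - α k₀ z) / α k₀ d := div_pos (sub_pos.2 (hlt k₀ hk₀'.ne')) hk₀'
  refine ⟨(β k₀ - α k₀ z) / α k₀ d, ht, fun k => ?_, ?_⟩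
  · rw [map_add, map_smul, smul_eq_mul]
    rcases le_or_gt (α k d) 0 with hk | hk
    · have := mul_nonpos_of_nonneg_of_nonpos ht.le hk
      linarith [hz k]
    · have := (le_div_iff₀ hk).1 (hmin k hk)
      linarith
  · refine (Set.ssubset_iff_of_subset ?_).2 ⟨k₀, hlt k₀ hk₀'.ne', ?_⟩
    · intro k hk
      refine (hz k).lt_of_ne fun h => ?_
      simp [hd k h, h] at hk
    · simp [div_mul_cancel₀ _ hk₀'.ne']

/-- If only lineality directions keep the constraints that are active at `z` active, then these
constraints define a minimal face. -/
lemma minimal_face_of_forall_eq_zero (α : κ → W →ₗ[ℝ] ℝ) (β : κ → ℝ) {z : W}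
    (hz : ∀ k, α k z ≤ β k)
    (hd : ∀ d, (∀ k, α k z = β k → α k d = 0) → ∀ k, α k d = 0) :
    Minimal (IsFace {v | ∀ k, α k v ≤ β k}) {v | ∀ k, α k v = α k z} := by
  refine ⟨⟨⟨z, fun _ => rfl⟩, ?_, ?_, ?_⟩, ?_⟩
  · intro v hv w hw a b _ _ hab k
    rw [map_add, map_smul, map_smul, hv k, hw k, ← add_smul, hab, one_smul]
  · intro v hv k
    rw [hv k]
    exact hz k
  · rintro v hv w hw u hu ⟨a, b, ha, hb, hab, rfl⟩ k
    have hact : ∀ k, α k z = β k → α k (v - z) = 0 := by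
      intro k hk
      have h1 := hu k
      simp only [map_add, map_smul, smul_eq_mul] at h1
      have h2 := mul_le_mul_of_nonneg_left (hw k) hb.le
      have h3 : a * β k + b * β k = β k := by rw [← add_mul, hab, one_mul]
      have h4 : a * β k ≤ a * α k v := by linarith
      have h5 := le_of_mul_le_mul_left h4 ha
      rw [map_sub, hk]
      linarith [hv k]
    have := hd _ hact k
    rw [map_sub] at this
    linarith
  · rintro T ⟨⟨t, ht⟩, -, hT⟩ hTS v hv
    -- `t` is the midpoint of `v` and `t + (t - v)`
    have htz := hTS ht
    refine hT.left_mem_of_mem_openSegment (y := t + (t - v)) (z := t) ?_ ?_ ht ?_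
    · intro k
      rw [hv k]
      exact hz k
    · intro k
      rw [map_add, map_sub, hv k, htz k]
      linarith [hz k]
    · refine ⟨1 / 2, 1 / 2, by norm_num, by norm_num, by norm_num, ?_⟩
      module

/-- A convex set that meets all minimal faces of a polyhedron and is closed under adding recession
directions of the polyhedron contains the polyhedron. -/
lemma subset_of_meets_minimal_faces [Finite κ] (α : κ → W →ₗ[ℝ] ℝ) (β : κ → ℝ) {C : Set W}
    (hC : Convex ℝ C) (hrec : ∀ c ∈ C, ∀ d, (∀ k, α k d ≤ 0) → c + d ∈ C)
    (hmeet : ∀ S, Minimal (IsFace {v | ∀ k, α k v ≤ β k}) S → (S ∩ C).Nonempty) :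
    {v | ∀ k, α k v ≤ β k} ⊆ C := by
  suffices H : ∀ (I : Set κ) (z : W), {k | α k z < β k} = I → (∀ k, α k z ≤ β k) → z ∈ C from
    fun z hz => H _ z rfl hz
  intro I
  induction I using WellFoundedLT.induction with
  | ind I ih =>
  rintro z rfl hz
  by_cases hd : ∀ d, (∀ k, α k z = β k → α k d = 0) → ∀ k, α k d = 0
  · obtain ⟨y, hy, hyC⟩ := hmeet _ (minimal_face_of_forall_eq_zero α β hz hd)
    have := hrec y hyC (z - y) fun k => by rw [map_sub, hy k, sub_self]
    simpa using this
  · obtain ⟨d, hact, hpos⟩ : ∃ d, (∀ k, α k z = β k → α k d = 0) ∧ ∃ k, 0 < α k d := by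
      push Not at hd
      obtain ⟨d, hact, k, hk⟩ := hd
      rcases lt_or_gt_of_ne hk with h | h
      · exact ⟨-d, fun k hk => by simp [hact k hk], k, by simpa using h⟩
      · exact ⟨d, hact, k, h⟩
    obtain ⟨t, ht, h1, h2⟩ := exists_fewer_inactive α β hz hact hpos
    have hzt : z + t • d ∈ C := ih _ h2 _ rfl h1
    by_cases hneg : ∃ k, 0 < α k (-d)
    · obtain ⟨s, hs, h3, h4⟩ :=
        exists_fewer_inactive α β hz (d := -d) (fun k hk => by simp [hact k hk]) hneg
      have hzs : z + s • (-d) ∈ C := ih _ h4 _ rfl h3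
      have := hC hzt hzs (a := s / (s + t)) (b := t / (s + t)) (by positivity) (by positivity)
        (by field_simp)
      convert this using 1
      have hst : s + t ≠ 0 := by positivity
      match_scalars <;> field_simp
      ring
    · push Not at hneg
      have := hrec _ hzt (t • (-d)) fun k => by
        rw [map_smul, smul_eq_mul]
        exact mul_nonpos_of_nonneg_of_nonpos ht.le (hneg k)
      simpa using this

/-- A segment joining two points of a polyhedron with the same active constraints can be
prolonged. -/
lemma exists_prolongation [Finite κ] (α : κ → W →ₗ[ℝ] ℝ) (β : κ → ℝ) {y z : W}
    (hz : ∀ k, α k z ≤ β k) (hact : ∀ k, α k z = β k → α k y = β k) :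
    ∃ ε : ℝ, 0 < ε ∧ ∀ k, α k (z + ε • (z - y)) ≤ β k := by
  by_cases hpos : ∃ k, 0 < α k (z - y)
  · obtain ⟨t, ht, h, -⟩ := exists_fewer_inactive α β hz
      (d := z - y) (fun k hk => by rw [map_sub, hk, hact k hk, sub_self]) hpos
    exact ⟨t, ht, h⟩
  · push Not at hpos
    refine ⟨1, one_pos, fun k => ?_⟩
    rw [one_smul, map_add]
    linarith [hz k, hpos k]

end Polyhedron

section SetValued

variable {n q : ℕ} {F : (Fin n → ℝ) → Set (Fin q → ℝ)}

/-! ### The value function and its fixed points -/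

lemma valueFun_anti : Antitone (valueFun F) :=
  fun _ _ h _ ⟨x, hz, hx⟩ => ⟨x, hz, h.trans hx⟩

lemma subset_valueFun {Y : Set (Fin q → ℝ)} {x : Fin n → ℝ} (h : Y ⊆ F x) :
    F x ⊆ valueFun F Y :=
  fun _ hz => ⟨x, hz, h⟩

/-- If `F` has nonempty domain, the empty set is not a fixed point of `v_F`. -/
lemma exists_eq_of_fixedPoint (hdom : (dom F).Nonempty) {Z : Set (Fin q → ℝ)}
    (hZ : Z = valueFun F Z) : ∃ x, Z = F x := by
  have hne : Z.Nonempty := by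
    rw [Set.nonempty_iff_ne_empty]
    rintro rfl
    obtain ⟨x, y, hy⟩ := hdom
    have : y ∈ valueFun F ∅ := ⟨x, hy, Set.empty_subset _⟩
    rwa [← hZ] at this
  obtain ⟨z, hz⟩ := hne
  rw [hZ] at hz
  obtain ⟨x, -, hx⟩ := hz
  exact ⟨x, hx.antisymm ((subset_valueFun hx).trans hZ.symm.subset)⟩

lemma isOptimizer_of_fixedPoint {x : Fin n → ℝ} (h : F x = valueFun F (F x)) :
    IsOptimizer F x := by
  rintro ⟨x', hx'⟩
  exact hx'.2 ((subset_valueFun hx'.1).trans h.symm.subset)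

lemma generatesFixedPoint_of_subset {Y : Set (Fin q → ℝ)} {x : Fin n → ℝ} (hY : Y ⊆ F x)
    (h : valueFun F Y ⊆ F x) : GeneratesFixedPoint F Y := by
  have he : valueFun F Y = F x := h.antisymm (subset_valueFun hY)
  have hfix : F x = valueFun F (F x) :=
    (subset_valueFun subset_rfl).antisymm ((valueFun_anti hY).trans h)
  exact ⟨F x, hfix, he.trans hfix⟩

lemma GeneratesFixedPoint.exists_eq (hdom : (dom F).Nonempty) {Y : Set (Fin q → ℝ)}
    (h : GeneratesFixedPoint F Y) : ∃ x, valueFun F Y = F x := by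
  obtain ⟨Z, hZ, hY⟩ := h
  obtain ⟨x, hx⟩ := exists_eq_of_fixedPoint hdom hZ
  exact ⟨x, hY.trans (hZ.symm.trans hx)⟩

lemma GeneratesFixedPoint.isOptimizer {Y : Set (Fin q → ℝ)} {x : Fin n → ℝ}
    (h : GeneratesFixedPoint F Y) (hx : valueFun F Y = F x) : IsOptimizer F x := by
  obtain ⟨Z, hZ, hY⟩ := h
  have : Z = F x := hZ.trans (hY.symm.trans hx)
  subst this
  exact isOptimizer_of_fixedPoint hZ

/-! ### Existence of a qualified choice -/

lemma mem_recessionCone_of_forall_le {V : Type*} [AddCommGroup V] [Module ℝ V] {m : ℕ}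
    {a : Fin m → V →ₗ[ℝ] ℝ} {b : Fin m → ℝ} {d : V} (hd : ∀ i, a i d ≤ 0) :
    d ∈ recessionCone {v | ∀ i, a i v ≤ b i} := by
  intro p hp t ht i
  rw [map_add, map_smul, smul_eq_mul]
  linarith [hp i, mul_nonpos_of_nonneg_of_nonpos ht (hd i)]

/-- For finite `Y`, `v_F(Y)` is a polyhedron. If `Y` is nonempty, its recession directions belong
to the natural ordering cone; for `Y = ∅` they need not. -/
lemma exists_description_valueFun (hF : IsPolyhedralConvex F) {Y : Set (Fin q → ℝ)}
    (hY : Y.Finite) :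
    ∃ (κ : Type) (_ : Finite κ) (α : κ → (Fin q → ℝ) →ₗ[ℝ] ℝ) (β : κ → ℝ),
      valueFun F Y = {z | ∀ k, α k z ≤ β k} ∧
      (Y.Nonempty → ∀ d, (∀ k, α k d ≤ 0) → d ∈ naturalOrderingCone F) := by
  obtain ⟨m, a, b, hab⟩ := hF
  have hmem : ∀ x z, z ∈ F x ↔ ∀ i, a i (x, z) ≤ b i := fun x z => by
    change (x, z) ∈ graph F ↔ _
    rw [hab]
    rfl
  have hsplit : ∀ i x z, a i (x, z) = a i (x, 0) + a i (0, z) := fun i x z => by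
    rw [← map_add]; simp
  have := hY.to_subtype
  -- The row `(i, none)` is `a i (x, z) ≤ b i`, the row `(i, some y)` is `a i (x, y) ≤ b i`. In both,
  -- `x` has the same coefficients; `B` holds the coefficients of `z`, `r` the right-hand sides.
  let B : (Fin q → ℝ) →ₗ[ℝ] (Fin m × Option Y → ℝ) := LinearMap.pi fun i =>
    match i.2 with
    | none => a i.1 ∘ₗ LinearMap.inr ℝ _ _
    | some _ => 0
  let r : Fin m × Option Y → ℝ := fun i =>
    match i.2 with
    | none => b i.1
    | some y => b i.1 - a i.1 (0, y)
  obtain ⟨κ, hκ, l, hl⟩ := exists_dual_description n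
    (fun i : Fin m × Option Y => a i.1 ∘ₗ LinearMap.inl ℝ _ _)
  refine ⟨κ, hκ, fun k => l k ∘ₗ B, fun k => l k r, ?_, ?_⟩
  · ext z
    have h1 := hl (r - B z)
    simp only [map_sub, sub_nonneg] at h1
    refine Iff.trans ?_ h1
    constructor
    · rintro ⟨x, hz, hYx⟩
      refine ⟨x, ?_⟩
      rintro ⟨i, _ | y⟩
      · have := (hmem _ _).1 hz i
        rw [hsplit] at this
        simp only [B, r, LinearMap.comp_apply, LinearMap.inl_apply, LinearMap.inr_apply,
          Pi.sub_apply, LinearMap.pi_apply]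
        linarith
      · have := (hmem _ _).1 (hYx y.2) i
        rw [hsplit] at this
        simp only [B, r, LinearMap.comp_apply, LinearMap.inl_apply,
          Pi.sub_apply, LinearMap.pi_apply, LinearMap.zero_apply]
        linarith
    · rintro ⟨x, hx⟩
      refine ⟨x, (hmem _ _).2 fun i => ?_, fun y hy => (hmem _ _).2 fun i => ?_⟩
      · have := hx (i, none)
        simp only [B, r, LinearMap.comp_apply, LinearMap.inl_apply, LinearMap.inr_apply,
          Pi.sub_apply, LinearMap.pi_apply] at this
        rw [hsplit]
        linarith
      · have := hx (i, some ⟨y, hy⟩)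
        simp only [B, r, LinearMap.comp_apply, LinearMap.inl_apply,
          Pi.sub_apply, LinearMap.pi_apply, LinearMap.zero_apply] at this
        rw [hsplit]
        linarith
  · rintro ⟨y, hy⟩ d hd
    -- the same elimination, applied to the homogeneous system
    obtain ⟨x, hx⟩ := (hl (-B d)).2 fun k => by
      rw [map_neg]
      exact neg_nonneg.2 (hd k)
    refine ⟨x, ?_, ?_⟩
    · change (x, d) ∈ recessionCone (graph F)
      rw [hab]
      refine mem_recessionCone_of_forall_le fun i => ?_
      have := hx (i, none)
      simp only [B, LinearMap.comp_apply, LinearMap.inl_apply, LinearMap.inr_apply,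
        Pi.neg_apply, LinearMap.pi_apply] at this
      rw [hsplit]
      linarith
    · change (x, 0) ∈ recessionCone (graph F)
      rw [hab]
      refine mem_recessionCone_of_forall_le fun i => ?_
      have := hx (i, some ⟨y, hy⟩)
      simpa [B] using this

lemma IsPolyhedralConvex.convex (hF : IsPolyhedralConvex F) (x : Fin n → ℝ) :
    Convex ℝ (F x) := by
  obtain ⟨m, a, b, hab⟩ := hF
  have hg : Convex ℝ (graph F) := by
    rw [hab, Set.ofPred_forall]
    exact convex_iInter fun i => convex_halfSpace_le (a i).isLinear (b i)
  intro y hy z hz s t hs ht hst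
  have h : s • (x, y) + t • (x, z) ∈ graph F := hg hy hz hs ht hst
  rwa [Prod.smul_mk, Prod.smul_mk, Prod.mk_add_mk, ← add_smul, hst, one_smul] at h

lemma exists_isQualified (hF : IsPolyhedralConvex F)
    (hK : naturalOrderingCone F = recessionFun F 0) {Y : Set (Fin q → ℝ)} (hY : Y.Finite)
    {x : Fin n → ℝ} (hx : (F x).Nonempty) (hYx : Y ⊆ F x) (hgen : ¬ GeneratesFixedPoint F Y) :
    ∃ y ∈ valueFun F Y, IsQualified F Y y := by
  by_contra hno
  have hmeet : ∀ S, Minimal (IsFace (valueFun F Y)) S → (S ∩ Y).Nonempty := by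
    intro S hS
    rw [Set.nonempty_iff_ne_empty]
    intro he
    obtain ⟨⟨y, hy⟩, -, hext⟩ := hS.prop
    exact hno ⟨y, hext.subset hy, S, hS, he, hy⟩
  obtain ⟨κ, hκ, α, β, hQ, hrec⟩ := exists_description_valueFun hF hY
  rw [hQ] at hmeet
  rcases Y.eq_empty_or_nonempty with rfl | hne
  · -- the empty set would contain the nonempty polyhedron `v_F(∅)`
    have hsub := subset_of_meets_minimal_faces α β convex_empty (by simp) hmeet
    rw [← hQ] at hsub
    obtain ⟨z, hz⟩ := hx
    exact hsub (subset_valueFun hYx hz)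
  · refine hgen (generatesFixedPoint_of_subset hYx ?_)
    rw [hQ]
    refine subset_of_meets_minimal_faces α β (hF.convex x) (fun c hc d hd => ?_)
      fun S hS => (hmeet S hS).mono (Set.inter_subset_inter_right _ hYx)
    have h := hrec hne d hd
    rw [hK] at h
    have h' : (x, c) + (1 : ℝ) • ((0 : Fin n → ℝ), d) ∈ graph F := h (x, c) hc 1 zero_le_one
    simpa [graph] using h'

/-! ### Executions of the algorithm -/

/-- What holds for every configuration reached from `loop ∅`. Nonemptiness of `F x` has to be
recorded because `Y` may be empty. -/
def Invariant (F : (Fin n → ℝ) → Set (Fin q → ℝ)) : Config n q → Prop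
  | .loop Y => Y.Finite ∧ ∃ x, (F x).Nonempty ∧ Y ⊆ F x
  | .done Y x => GeneratesFixedPoint F Y ∧ valueFun F Y = F x

lemma invariant_start (hdom : (dom F).Nonempty) : Invariant F (Config.loop ∅) := by
  obtain ⟨x, hx⟩ := hdom
  exact ⟨Set.finite_empty, x, hx, Set.empty_subset _⟩

lemma Step.invariant {s t : Config n q} (h : Step F s t) (hs : Invariant F s) :
    Invariant F t := by
  cases h with
  | decision Y y _ hy =>
    obtain ⟨x, hyx, hYx⟩ := hy
    exact ⟨hs.1.union (Set.finite_singleton y), x, ⟨y, hyx⟩,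
      Set.union_subset hYx (Set.singleton_subset_iff.2 hyx)⟩
  | output Y x hguard hx => exact ⟨hguard, hx⟩

lemma exists_step_loop (hdom : (dom F).Nonempty) {Y : Set (Fin q → ℝ)}
    (h : Invariant F (Config.loop Y)) : ∃ t, Step F (Config.loop Y) t := by
  by_cases hgen : GeneratesFixedPoint F Y
  · obtain ⟨x, hx⟩ := hgen.exists_eq hdom
    exact ⟨_, Step.output Y x hgen hx⟩
  · obtain ⟨-, x, ⟨y, hy⟩, hYx⟩ := h
    exact ⟨_, Step.decision Y y hgen (subset_valueFun hYx hy)⟩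

/-- If `y ∈ Y` and `z` lie in a common value `F x ⊇ Y` and have the same active constraints there,
then the choice of `z` is not qualified. -/
lemma not_isQualified_of_active_eq {m : ℕ} (a : Fin m → (Fin n → ℝ) × (Fin q → ℝ) →ₗ[ℝ] ℝ)
    (b : Fin m → ℝ) (hab : graph F = {v | ∀ i, a i v ≤ b i}) {Y : Set (Fin q → ℝ)}
    {x : Fin n → ℝ} (hYx : Y ⊆ F x) {y z : Fin q → ℝ} (hy : y ∈ Y) (hz : z ∈ F x)
    (hact : {i | a i (x, y) = b i} = {i | a i (x, z) = b i}) : ¬ IsQualified F Y z := by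
  rintro ⟨S, hS, hSY, hzS⟩
  have hsplit : ∀ i z, a i (x, z) = a i (x, 0) + a i (0, z) := fun i z => by
    rw [← map_add]; simp
  have hmem : ∀ z, z ∈ F x ↔ ∀ i, a i (0, z) ≤ b i - a i (x, 0) := fun z => by
    change (x, z) ∈ graph F ↔ _
    rw [hab]
    refine forall_congr' fun i => ?_
    rw [hsplit, le_sub_iff_add_le']
  obtain ⟨ε, hε, hw⟩ := exists_prolongation (fun i => a i ∘ₗ LinearMap.inr ℝ _ _)
    (fun i => b i - a i (x, 0)) (y := y) (z := z) ((hmem z).1 hz) fun i hi => by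
      have hi' : i ∈ {i | a i (x, z) = b i} := by
        change a i (0, z) = _ at hi
        rw [Set.mem_ofPred_eq, hsplit, hi]
        ring
      rw [← hact, Set.mem_ofPred_eq, hsplit] at hi'
      change a i (0, y) = _
      linarith
  have hsub := subset_valueFun hYx
  have hyS : y ∈ S := by
    refine hS.prop.2.2.left_mem_of_mem_openSegment (hsub (hYx hy))
      (hsub ((hmem (z + ε • (z - y))).2 hw)) hzS ?_
    refine ⟨ε / (1 + ε), 1 / (1 + ε), by positivity, by positivity, by field_simp; ring, ?_⟩
    have : 1 + ε ≠ 0 := by positivity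
    match_scalars <;> field_simp
    ring
  exact (hSY.subset ⟨hyS, hy⟩).elim

/-- There is no infinite sequence of decision-making steps with only finitely many unqualified
ones. -/
lemma exists_ge_not_isQualified (hF : IsPolyhedralConvex F) {Y : ℕ → Set (Fin q → ℝ)}
    {y : ℕ → Fin q → ℝ} (hsucc : ∀ k, Y (k + 1) = Y k ∪ {y k})
    (hx : ∀ k, ∃ x, Y k ⊆ F x) (K : ℕ) : ∃ k ≥ K, ¬ IsQualified F (Y k) (y k) := by
  obtain ⟨m, a, b, hab⟩ := hF
  have hmono : Monotone Y := monotone_nat_of_le_succ fun k => by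
    rw [hsucc]; exact Set.subset_union_left
  have hyY : ∀ {j k}, j < k → y j ∈ Y k := fun {j k} hjk =>
    hmono (Nat.succ_le_of_lt hjk) (by rw [hsucc]; exact Or.inr rfl)
  classical
  -- one step more than there are active sets
  let M := Fintype.card (Set (Fin m)) + 1
  obtain ⟨x, hYx⟩ := hx (K + M)
  obtain ⟨i, j, hne, heq⟩ := Fintype.exists_ne_map_eq_of_card_lt
    (fun k : Fin M => {i | a i (x, y (K + k)) = b i}) (by simp [M])
  wlog hij : i < j generalizing i j
  · exact this j i hne.symm heq.symm (lt_of_le_of_ne (not_lt.1 hij) hne.symm)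
  refine ⟨K + j, Nat.le_add_right _ _, ?_⟩
  exact not_isQualified_of_active_eq a b hab ((hmono (by omega)).trans hYx)
    (hyY (by omega)) (hYx (hyY (by omega))) heq

lemma IsExecution.ne_top (hF : IsPolyhedralConvex F) (hdom : (dom F).Nonempty) {N : ℕ∞}
    {s : ℕ → Config n q} (hs : IsExecution F N s)
    (hfin : {k : ℕ | (k : ℕ∞) < N ∧ IsUnqualifiedStep F (s k) (s (k + 1))}.Finite) : N ≠ ⊤ := by
  rintro rfl
  have hstep : ∀ k, Step F (s k) (s (k + 1)) := fun k => hs.step k (ENat.natCast_lt_top k)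
  have hinv : ∀ k, Invariant F (s k) := by
    intro k
    induction k with
    | zero => rw [hs.start]; exact invariant_start hdom
    | succ k ih => exact (hstep k).invariant ih
  -- an output step cannot be followed by another step, so all steps are decisions
  have hdec : ∀ k, ∃ Y y, ¬ GeneratesFixedPoint F Y ∧ y ∈ valueFun F Y ∧
      s k = Config.loop Y ∧ s (k + 1) = Config.loop (Y ∪ {y}) := by
    intro k
    have h1 := hstep k
    have h2 := hstep (k + 1)
    generalize s k = u at h1
    generalize s (k + 1) = v at h1 h2
    cases h1 with
    | decision Y y hguard hy => exact ⟨Y, y, hguard, hy, rfl, rfl⟩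
    | output Y x _ _ => cases h2
  choose Y y hguard hy hsY hsucc using hdec
  obtain ⟨K, hK⟩ := hfin.bddAbove
  obtain ⟨k, hk, hunq⟩ := exists_ge_not_isQualified hF (Y := Y) (y := y)
    (fun k => by simpa [hsY] using hsucc k)
    (fun k => by
      have h := hinv k
      rw [hsY k] at h
      obtain ⟨-, x, -, hx⟩ := h
      exact ⟨x, hx⟩) (K + 1)
  have := hK ⟨ENat.natCast_lt_top k, Y k, y k, hguard k, hy k, hsY k, hsucc k, hunq⟩
  omega

end SetValued

end OptimizerDesign

theorem theorem1 (n q : ℕ) (F : (Fin n → ℝ) → Set (Fin q → ℝ))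
    (hF : IsPolyhedralConvex F) (hdom : (dom F).Nonempty)
    (hK : naturalOrderingCone F = recessionFun F 0) :
    -- a qualified choice is possible whenever the algorithm reaches a decision-making step
    (∀ Y : Set (Fin q → ℝ),
      Relation.ReflTransGen (Step F) (Config.loop ∅) (Config.loop Y) →
      ¬ GeneratesFixedPoint F Y → ∃ y ∈ valueFun F Y, IsQualified F Y y) ∧
    -- every execution with at most finitely many unqualified steps is finite and correct
    (∀ (N : ℕ∞) (s : ℕ → Config n q), IsExecution F N s →
      {k : ℕ | (k : ℕ∞) < N ∧ IsUnqualifiedStep F (s k) (s (k + 1))}.Finite →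
      ∃ (m : ℕ) (Y : Set (Fin q → ℝ)) (x : Fin n → ℝ),
        N = (m : ℕ∞) ∧ s m = Config.done Y x ∧ valueFun F Y = F x ∧ IsOptimizer F x) := by
  constructor
  · intro Y hreach hgen
    have hinv : ∀ t, Relation.ReflTransGen (Step F) (Config.loop ∅) t → Invariant F t := by
      intro t ht
      induction ht with
      | refl => exact invariant_start hdom
      | tail _ h ih => exact h.invariant ih
    obtain ⟨hY, x, hx, hYx⟩ := hinv _ hreach
    exact exists_isQualified hF hK hY hx hYx hgen
  · intro N s hs hfin
    obtain ⟨m, rfl⟩ := ENat.ne_top_iff_exists.1 (hs.ne_top hF hdom hfin)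
    have hinv : ∀ k ≤ m, Invariant F (s k) := by
      intro k hk
      induction k with
      | zero => rw [hs.start]; exact invariant_start hdom
      | succ k ih => exact (hs.step k (by exact_mod_cast hk)).invariant (ih (by omega))
    have hm := hinv m le_rfl
    have hcomplete := hs.complete m rfl
    cases hsm : s m with
    | loop Y =>
      rw [hsm] at hm hcomplete
      obtain ⟨t, ht⟩ := exists_step_loop hdom hm
      exact (hcomplete t ht).elim
    | done Y x =>
      rw [hsm] at hm
      exact ⟨m, Y, x, rfl, hsm, hm.2, hm.1.isOptimizer hm.2⟩
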